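/- Identify $\mathbb R^3$ with $\mathbb R^2\times\mathbb R$, let $\pi_{\mathrm{flat}}:\mathbb R^3\to\mathbb R^2$ be the projection to the first two coordinates, and let $m$ be Lebesgue measure. Let $\mathrm{Aut}$ be the group of matrices $a=\begin{pmatrix} g & v\\ 0&1\end{pmatrix}$ with $g\in \mathrm{SL}(2,\mathbb R)$, $v\in\mathbb R^2$ (the volume and orientation preserving automorphisms of the real Heisenberg group), acting on $\mathbb R^3$ by $a\cdot(p,t)=(g^*p,\;t-v^{t}g^*p)$ with $g^*=(g^{-1})^{t}$. A Heisenberg lattice is a set $\Lambda=a\cdot\mathbb Z^3$ with $a\in \mathrm{Aut}$; the space $X_{\mathbf H}$ of all of them is the homogeneous space $\mathrm{Aut}/\mathrm{Aut}(\mathbb Z)$, where $\mathrm{Aut}(\mathbb Z)=\mathrm{SL}(2,\mathbb Z)\ltimes\mathbb Z^2$, and $\mu_{\mathbf H}$ is its $\mathrm{Aut}$-invariant probability measure (projected Haar measure). The set $\Lambda_{\mathrm{prim}}$ of primitive points of $\Lambda=a\cdot \mathbb Z^3$ consists of the points $a\cdot(k,l,n)$ with $k,l,n\in\mathbb Z$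 and $\gcd(k,l)=1$. A cylinder is a set $B\times I$ with $B\subset\mathbb R^2$ Borel and $I\subset\mathbb R$ an interval. For $\epsilon,R>0$ put $$Z_\circ=Z_\circ(\epsilon,R)=(\mathbb Z^2+B(0,\epsilon))\cap B(0,R)\subset\mathbb R^2 .$$ **Proposition.** There are constants $c(\epsilon')>0$, depending only on $\epsilon'>0$, such that for every $\epsilon>0$ the following hold. (a) There is $\delta>0$, depending only on $\epsilon$, such that for every $R>0$, every Borel set $A\subset B(0,R)\setminus Z_\circ$ of positive measure, and every real number $M$, there is a Borel set $S\subset\mathbb R^3$ with the following properties: 1. $M\le m(S)<\infty$; 2. for every $\epsilon'>0$ and every cylinder $C$, $m(C\,\triangle\, S)> c(\epsilon')\,m(S)^{1-\epsilon'}$; 3. $\pi_{\mathrm{flat}}(S)=A$; 4. $\mu_{\mathbf H}(\Lambda\in X_{\mathbf H}: S\cap\Lambda=\emptyset)\ge\delta$; 5. no Chebyshev bound with constant $M$ holds for $S$: there is $r>0$ with $$\mu_{\mathbf H}\Big(\Lambda\in X_{\mathbf H}:\Big|\#(S\cap\Lambda_{\mathrm{prim}})-\frac{m(S)}{\zeta(2)}\Big|>r\sqrt{m(S)}\Big)>\frac{M}{r^2}.$$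 (b) For every $R>0$ there is $\delta'>0$, depending only on $\epsilon$ and $R$, such that every Borel set $S\subset\mathbb R^3$ with $\pi_{\mathrm{flat}}(S)\subset B(0,R)\setminus Z_\circ$ satisfies $$\mu_{\mathbf H}(\Lambda\in X_{\mathbf H}: S\cap\Lambda=\emptyset)\ge\delta'.$$ -/

import Mathlib

open MeasureTheory Set

namespace HeisenbergLattice

/-- The flat plane `ℝ²`, with its Euclidean norm and Lebesgue measure. -/
abbrev Plane : Type := EuclideanSpace ℝ (Fin 2)

/-- The space `ℝ³ = ℝ² × ℝ` underlying the real Heisenberg group, with Lebesgue measure; the second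
factor is the central direction, and `Prod.fst` is the flat projection. -/
abbrev Space : Type := Plane × ℝ

/-- The group `Aut⁺₁(ℝ) ≃ SL(2, ℝ) ⋉ ℝ²` of volume and orientation preserving automorphisms of the
real Heisenberg group, written as the group of all real matrices `(g v; 0 1)` with
`g ∈ SL(2, ℝ)` and `v ∈ ℝ²`. -/
def HAut : Subgroup (Matrix.SpecialLinearGroup (Fin 3) ℝ) where
  carrier := {a | a 2 0 = 0 ∧ a 2 1 = 0 ∧ a 2 2 = 1}
  one_mem' := by simp
  mul_mem' := by
    rintro a b ⟨h0, h1, h2⟩ ⟨k0, k1, k2⟩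
    simp [Matrix.mul_apply, Fin.sum_univ_three, h0, h1, h2, k0, k1, k2]
  inv_mem' := by
    rintro a ⟨h0, h1, h2⟩
    have hd : a 0 0 * a 1 1 - a 0 1 * a 1 0 = 1 := by
      have h := a.det_coe
      rw [Matrix.det_fin_three, h0, h1, h2] at h
      linarith
    simp only [mem_ofPred_eq, Matrix.SpecialLinearGroup.coe_inv, Matrix.adjugate_fin_three]
    simp [h0, h1]
    linarith

/-- The matrix of an element of `HAut`. -/
def HAut.mat (a : HAut) : Matrix (Fin 3) (Fin 3) ℝ := (a : Matrix.SpecialLinearGroup (Fin 3) ℝ).1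

/-- The action of `Aut⁺₁(ℝ)` on the Heisenberg group through the inverse transpose matrix; for
`a = (g v; 0 1)` and `g* = (g⁻¹)ᵗ` it sends `(p, t)` to `(g* p, t - vᵗ g* p)`. -/
noncomputable def act (a : HAut) (w : Space) : Space :=
  let u : Fin 3 → ℝ := Matrix.mulVec (HAut.mat a⁻¹).transpose ![w.1 0, w.1 1, w.2]
  (!₂[u 0, u 1], u 2)

/-- The integer point `(m, n, k)` of the Heisenberg group. -/
noncomputable def intPoint (m n k : ℤ) : Space := (!₂[(m : ℝ), (n : ℝ)], (k : ℝ))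

/-- The Heisenberg lattice `a · ℤ³`. -/
def lattice (a : HAut) : Set Space := {w | ∃ m n k : ℤ, w = act a (intPoint m n k)}

/-- The space `X_H` of Heisenberg lattices: the orbit of `ℤ³` under `Aut⁺₁(ℝ)`. -/
def XH : Type := {L : Set Space // ∃ a : HAut, L = lattice a}

/-- The orbit map `a ↦ a · ℤ³`. -/
def toXH (a : HAut) : XH := ⟨lattice a, a, rfl⟩

instance : MeasurableSpace HAut := borel HAut

instance : BorelSpace HAut := ⟨rfl⟩

/-- The quotient σ-algebra on the orbit `X_H = Aut⁺₁(ℝ) / Aut⁺₁(ℤ)`. -/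
instance : MeasurableSpace XH := MeasurableSpace.map toXH inferInstance

instance : LocallyCompactSpace HAut := by
  have : LocallyCompactSpace (Matrix (Fin 3) (Fin 3) ℝ) :=
    inferInstanceAs (LocallyCompactSpace (Fin 3 → Fin 3 → ℝ))
  have : LocallyCompactSpace (Matrix.SpecialLinearGroup (Fin 3) ℝ) :=
    Matrix.SpecialLinearGroup.isClosedEmbedding_val.locallyCompactSpace
  have hc : IsClosed (HAut : Set (Matrix.SpecialLinearGroup (Fin 3) ℝ)) := by
    have h (i j : Fin 3) :
        Continuous fun a : Matrix.SpecialLinearGroup (Fin 3) ℝ => a i j :=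
      (Continuous.matrix_elem continuous_id i j).comp continuous_subtype_val
    exact (isClosed_eq (h 2 0) continuous_const).inter
      ((isClosed_eq (h 2 1) continuous_const).inter (isClosed_eq (h 2 2) continuous_const))
  exact hc.isClosedEmbedding_subtypeVal.locallyCompactSpace

/-- The block `g ∈ SL(2, ℝ)` of `(g v; 0 1)`. -/
def linPart (a : HAut) : Matrix.SpecialLinearGroup (Fin 2) ℝ :=
  ⟨!![HAut.mat a 0 0, HAut.mat a 0 1; HAut.mat a 1 0, HAut.mat a 1 1], by
    obtain ⟨a, h0, h1, h2⟩ := a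
    have h := a.det_coe
    rw [Matrix.det_fin_three, h0, h1, h2] at h
    rw [Matrix.det_fin_two_of]
    simp only [HAut.mat]
    linarith⟩

/-- A fundamental set for the right action of `Aut⁺₁(ℤ) = SL(2, ℤ) ⋉ ℤ²` on `Aut⁺₁(ℝ)`: the matrices
whose inverse `(h w; 0 1)` has `h · i` in the standard fundamental domain of the modular group and
`w ∈ [0, 1)²`. Outside a null set every orbit meets it in exactly two points (the matrices
`diag (-1, -1, 1)` and `1` act in the same way on the upper half plane), so that
normalized Haar measure on it projects to the invariant probability measure on the quotient. -/
def fundamentalSet : Set HAut :=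
  {a | linPart a⁻¹ • UpperHalfPlane.I ∈ ModularGroup.fd ∧
    HAut.mat a⁻¹ 0 2 ∈ Ico (0 : ℝ) 1 ∧ HAut.mat a⁻¹ 1 2 ∈ Ico (0 : ℝ) 1}

/-- The projected Haar probability measure on the space of Heisenberg lattices, that is, the
probability measure on `X_H` invariant under `Aut⁺₁(ℝ)`: Haar measure of `Aut⁺₁(ℝ)` on a
fundamental set for `Aut⁺₁(ℤ)`, normalized to total mass one and pushed forward to `X_H`. -/
noncomputable def muH : Measure XH :=
  (ProbabilityTheory.cond (Measure.haar : Measure HAut) fundamentalSet).map toXH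

/-- The primitive points of a Heisenberg lattice: the points `a (m, n, k)` with `gcd (m, n) = 1`,
where the lattice is `a · ℤ³`. -/
def primitivePoints (L : XH) : Set Space :=
  {w | ∃ (a : HAut) (m n k : ℤ),
    L.1 = lattice a ∧ Int.gcd m n = 1 ∧ w = act a (intPoint m n k)}

/-- The lattices that miss `S`. -/
def missing (S : Set Space) : Set XH := {L | S ∩ L.1 = ∅}

/-- The lattices `L` with `|#(S ∩ L_prim) - m(S) / ζ(2)| > r √m(S)` (an infinite number of primitive
points in `S` counts as a deviation). -/
def deviating (S : Set Space) (r : ℝ) : Set XH :=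
  {L | (S ∩ primitivePoints L).Infinite ∨
    r * √(volume S).toReal <
      |((S ∩ primitivePoints L).ncard : ℝ) - (volume S).toReal / (riemannZeta 2).re|}

/-- The part `(ℤ² + B(0, ε)) ∩ B(0, R)` of the thickened standard lattice in the ball. -/
def thickening (ε R : ℝ) : Set Plane :=
  {x | ∃ m n : ℤ, x ∈ Metric.ball (!₂[(m : ℝ), (n : ℝ)] : Plane) ε} ∩ Metric.ball 0 R

/-- A cylinder in `ℝ³`: a product `B × I` of a Borel set `B ⊆ ℝ²` and an interval `I ⊆ ℝ`. -/
def IsCylinder (C : Set Space) : Prop :=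
  ∃ (B : Set Plane) (I : Set ℝ), MeasurableSet B ∧ I.OrdConnected ∧ C = B ×ˢ I

end HeisenbergLattice

namespace HeisenbergLattice

/-! If `a⁻¹ = (h w; 0 1)`, the points of `a · ℤ³` over the integer vector `(m, n)` have flat part
`hᵗ(m, n)` and central parts running through a full coset of `ℤ`, that of `w · (m, n)`. Hence a comb
`A × ⋃ [j, j + η)` is missed as soon as no `hᵗ(m, n)` in `A` has `w · (m, n)` in `[0, η)` modulo 1,
whatever the number of teeth: the measure of the comb can grow while the missing lattices do not
change.

For (a), let `η → 0` with `R` fixed. The exceptional automorphisms shrink to a set where `w · (m,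
n)` is an integer for some `(m, n) ≠ 0`, which is Haar null, so some `η` leaves exceptional mass at
most 1/2 (`exists_fundamentalMeasure_badSet_le`); thus `δ = 1/2` works. The thickening contains the
origin, so `(m, n) = 0` never matters. A comb with `3J` teeth differs from every cylinder by at
least a third of its measure (`volume_symmDiff_cylinder_ge`). A missing lattice deviates by
`m(S)/ζ(2)`, of order `m(S)` rather than `√m(S)`, with probability at least 1/2, which defeats
Chebyshev for large `J`.

For (b), if `h` is close to the identity, every flat part inside `B(0, R)` is within `ε` of `ℤ²`, so
such lattices miss `S` (`toXH_mem_missing_of_nearIdentity`), and they have positive mass.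

The measure theory rests on a concrete model of Haar measure, `coneMeasure`, in which `w` is a free
Lebesgue variable; it yields the null sets and the finite mass of the fundamental set. -/

/-- The entries of the matrix `(h w; 0 1)` of `a⁻¹`. -/
def invEntry (a : HAut) (i j : Fin 3) : ℝ := HAut.mat a⁻¹ i j

lemma invEntry_two_zero (a : HAut) : invEntry a 2 0 = 0 := (a⁻¹).2.1
lemma invEntry_two_one (a : HAut) : invEntry a 2 1 = 0 := (a⁻¹).2.2.1
lemma invEntry_two_two (a : HAut) : invEntry a 2 2 = 1 := (a⁻¹).2.2.2

lemma invEntry_det (a : HAut) :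
    invEntry a 0 0 * invEntry a 1 1 - invEntry a 0 1 * invEntry a 1 0 = 1 := by
  have h := (a⁻¹).1.det_coe
  have h0 := invEntry_two_zero a
  have h1 := invEntry_two_one a
  have h2 := invEntry_two_two a
  simp only [invEntry, HAut.mat] at *
  rw [Matrix.det_fin_three] at h
  rw [h0, h1, h2] at h
  linarith

/-! ### Matrix coordinates on the group and the fundamental domain in these coordinates. -/

/-- The matrix entries, as a map to the space of functions of two indices. -/
def entries (a : HAut) : Fin 3 → Fin 3 → ℝ := fun i j => HAut.mat a i j

lemma isClosedEmbedding_entries : Topology.IsClosedEmbedding entries := by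
  have hc : IsClosed (HAut : Set (Matrix.SpecialLinearGroup (Fin 3) ℝ)) := by
    have h (i j : Fin 3) :
        Continuous fun a : Matrix.SpecialLinearGroup (Fin 3) ℝ => a i j :=
      (Continuous.matrix_elem continuous_id i j).comp continuous_subtype_val
    exact (isClosed_eq (h 2 0) continuous_const).inter
      ((isClosed_eq (h 2 1) continuous_const).inter (isClosed_eq (h 2 2) continuous_const))
  exact (Matrix.SpecialLinearGroup.isClosedEmbedding_val (n := Fin 3) (R := ℝ)).comp
    hc.isClosedEmbedding_subtypeVal

instance : SecondCountableTopology HAut :=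
  isClosedEmbedding_entries.isEmbedding.secondCountableTopology

lemma continuous_mat (i j : Fin 3) : Continuous fun a : HAut => HAut.mat a i j :=
  (continuous_apply_apply i j).comp isClosedEmbedding_entries.continuous

lemma continuous_invEntry (i j : Fin 3) : Continuous fun a : HAut => invEntry a i j :=
  (continuous_mat i j).comp continuous_inv

lemma measurable_of_entries {α : Type*} [MeasurableSpace α] {f : α → HAut}
    (hf : ∀ i j, Measurable fun x => HAut.mat (f x) i j) : Measurable f :=
  isClosedEmbedding_entries.measurableEmbedding.measurable_comp_iff.1
    (measurable_pi_lambda _ fun i => measurable_pi_lambda _ fun j => hf i j)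

lemma HAut.ext_mat {a b : HAut} (h : HAut.mat a = HAut.mat b) : a = b :=
  Subtype.ext (Subtype.ext h)

lemma HAut.mat_mul (a b : HAut) : HAut.mat (a * b) = HAut.mat a * HAut.mat b := rfl

/-- The automorphism `(h w; 0 1)`, where `h` has rows `r` and `s`. -/
def ofRows (r s w : Fin 2 → ℝ) (h : r 0 * s 1 - r 1 * s 0 = 1) : HAut :=
  ⟨⟨!![r 0, r 1, w 0; s 0, s 1, w 1; 0, 0, 1], by
    rw [Matrix.det_fin_three]; simp; linarith⟩, by
    refine ⟨?_, ?_, ?_⟩ <;> simp⟩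

lemma mat_ofRows (r s w : Fin 2 → ℝ) (h : r 0 * s 1 - r 1 * s 0 = 1) :
    HAut.mat (ofRows r s w h) = !![r 0, r 1, w 0; s 0, s 1, w 1; 0, 0, 1] := rfl

lemma act_intPoint (a : HAut) (m n k : ℤ) :
    act a (intPoint m n k) =
      (!₂[invEntry a 0 0 * m + invEntry a 1 0 * n, invEntry a 0 1 * m + invEntry a 1 1 * n],
        invEntry a 0 2 * m + invEntry a 1 2 * n + k) := by
  have h0 := invEntry_two_zero a
  have h1 := invEntry_two_one a
  have h2 := invEntry_two_two a
  simp only [invEntry] at *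
  simp only [act, intPoint, Matrix.mulVec, dotProduct, Fin.sum_univ_three, Matrix.transpose_apply,
    h0, h1, h2]
  simp

lemma linPart_smul_I_mem_fd_iff (a : HAut) :
    linPart a⁻¹ • UpperHalfPlane.I ∈ ModularGroup.fd ↔
      invEntry a 1 0 ^ 2 + invEntry a 1 1 ^ 2 ≤ invEntry a 0 0 ^ 2 + invEntry a 0 1 ^ 2 ∧
      |invEntry a 0 0 * invEntry a 1 0 + invEntry a 0 1 * invEntry a 1 1| ≤
        (invEntry a 1 0 ^ 2 + invEntry a 1 1 ^ 2) / 2 := by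
  have hd := invEntry_det a
  set p := invEntry a 0 0 with hp
  set q := invEntry a 0 1 with hq
  set r := invEntry a 1 0 with hr
  set s := invEntry a 1 1 with hs
  have hpos : 0 < r ^ 2 + s ^ 2 := by
    by_contra hcon
    have h1 : r = 0 := by nlinarith [sq_nonneg r, sq_nonneg s]
    have h2 : s = 0 := by nlinarith [sq_nonneg r, sq_nonneg s]
    rw [h1, h2] at hd; norm_num at hd
  have hz : ((linPart a⁻¹ • UpperHalfPlane.I : UpperHalfPlane) : ℂ) =
      (p * Complex.I + q) / (r * Complex.I + s) := by
    rw [UpperHalfPlane.specialLinearGroup_apply]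
    simp [linPart, hp, hq, hr, hs, invEntry]
  have hn1 : Complex.normSq (p * Complex.I + q) = p ^ 2 + q ^ 2 := by
    simp [Complex.normSq_apply]; ring
  have hn2 : Complex.normSq (r * Complex.I + s) = r ^ 2 + s ^ 2 := by
    simp [Complex.normSq_apply]; ring
  have hre : (linPart a⁻¹ • UpperHalfPlane.I : UpperHalfPlane).re =
      (p * r + q * s) / (r ^ 2 + s ^ 2) := by
    rw [← UpperHalfPlane.coe_re, hz, Complex.div_re, hn2]
    simp; field_simp; ring
  simp only [ModularGroup.fd, mem_ofPred_eq, hz, hre, map_div₀, hn1, hn2, abs_div, abs_of_pos hpos]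
  rw [le_div_iff₀ hpos, div_le_iff₀ hpos]
  constructor <;> rintro ⟨h1, h2⟩ <;> constructor <;> linarith

/-! ### Haar measure as Lebesgue measure on the cone over the group. -/

/-- Triples of two rows of a matrix and a translation vector. -/
abbrev Rows : Type := ((Fin 2 → ℝ) × (Fin 2 → ℝ)) × (Fin 2 → ℝ)

/-- The determinant of the two rows. -/
def Rows.det (x : Rows) : ℝ := x.1.1 0 * x.1.2 1 - x.1.1 1 * x.1.2 0

lemma Rows.continuous_det : Continuous Rows.det := by
  unfold Rows.det; fun_prop

/-- The cone over the special linear group. -/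
def cone : Set Rows := Rows.det ⁻¹' Ioc 0 1

lemma measurableSet_cone : MeasurableSet cone :=
  Rows.continuous_det.measurable measurableSet_Ioc

lemma scaled_det {x : Rows} (h : 0 < x.det) :
    ((√x.det)⁻¹ • x.1.1) 0 * ((√x.det)⁻¹ • x.1.2) 1 -
      ((√x.det)⁻¹ • x.1.1) 1 * ((√x.det)⁻¹ • x.1.2) 0 = 1 := by
  have h1 : (√x.det)⁻¹ * (√x.det)⁻¹ * x.det = 1 := by
    rw [← mul_inv, Real.mul_self_sqrt h.le, inv_mul_cancel₀ h.ne']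
  calc _ = (√x.det)⁻¹ * (√x.det)⁻¹ * x.det := by
        simp only [Pi.smul_apply, smul_eq_mul, Rows.det]; ring
    _ = 1 := h1

open Classical in
/-- The radial projection of the cone to the group. -/
noncomputable def radial (x : Rows) : HAut :=
  if h : 0 < x.det then ofRows ((√x.det)⁻¹ • x.1.1) ((√x.det)⁻¹ • x.1.2) x.2 (scaled_det h) else 1

lemma mat_radial {x : Rows} (h : 0 < x.det) :
    HAut.mat (radial x) = !![(√x.det)⁻¹ * x.1.1 0, (√x.det)⁻¹ * x.1.1 1, x.2 0;
      (√x.det)⁻¹ * x.1.2 0, (√x.det)⁻¹ * x.1.2 1, x.2 1; 0, 0, 1] := by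
  rw [radial, dif_pos h, mat_ofRows]; rfl

lemma measurable_radial : Measurable radial := by
  refine measurable_of_entries fun i j => ?_
  have hd := Rows.continuous_det.measurable
  have : (fun x => HAut.mat (radial x) i j) = fun x : Rows => if 0 < x.det then
      (!![(√x.det)⁻¹ * x.1.1 0, (√x.det)⁻¹ * x.1.1 1, x.2 0;
      (√x.det)⁻¹ * x.1.2 0, (√x.det)⁻¹ * x.1.2 1, x.2 1; 0, 0, 1] : Matrix (Fin 3) (Fin 3) ℝ) i j
      else (1 : Matrix (Fin 3) (Fin 3) ℝ) i j := by
    ext x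
    split_ifs with h
    · rw [mat_radial h]
    · rw [radial, dif_neg h]; rfl
  rw [this]
  refine Measurable.ite (measurableSet_lt measurable_const hd) ?_ measurable_const
  fin_cases i <;> fin_cases j <;> simp <;> fun_prop

/-- The left invariant measure on the group obtained from Lebesgue measure on the cone. -/
noncomputable def coneMeasure : Measure HAut :=
  (volume.restrict cone).map fun x => (radial x)⁻¹

lemma measurable_radial_inv : Measurable fun x => (radial x)⁻¹ :=
  continuous_inv.measurable.comp measurable_radial

/-- Right multiplication by `(h w; 0 1)` in the coordinates of the cone. -/
noncomputable def rightMul (b : HAut) (x : Rows) : Rows :=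
  ((Matrix.toLin' !![HAut.mat b 0 0, HAut.mat b 1 0; HAut.mat b 0 1, HAut.mat b 1 1] x.1.1,
    Matrix.toLin' !![HAut.mat b 0 0, HAut.mat b 1 0; HAut.mat b 0 1, HAut.mat b 1 1] x.1.2),
    x.2 + ![(√x.det)⁻¹ * (x.1.1 0 * HAut.mat b 0 2 + x.1.1 1 * HAut.mat b 1 2),
      (√x.det)⁻¹ * (x.1.2 0 * HAut.mat b 0 2 + x.1.2 1 * HAut.mat b 1 2)])

lemma mat_det (b : HAut) :
    HAut.mat b 0 0 * HAut.mat b 1 1 - HAut.mat b 0 1 * HAut.mat b 1 0 = 1 := by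
  have := invEntry_det b⁻¹
  simpa only [invEntry, inv_inv] using this

lemma det_rightMul (b : HAut) (x : Rows) : (rightMul b x).det = x.det := by
  have h := mat_det b
  simp only [rightMul, Rows.det, Matrix.toLin'_apply, Matrix.mulVec, dotProduct,
    Fin.sum_univ_two, Matrix.of_apply, Matrix.cons_val', Matrix.cons_val_zero,
    Matrix.cons_val_one, Matrix.cons_val_fin_one]
  linear_combination (x.1.1 0 * x.1.2 1 - x.1.1 1 * x.1.2 0) * h

lemma radial_rightMul (b : HAut) {x : Rows} (hx : 0 < x.det) :
    radial (rightMul b x) = radial x * b := by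
  apply HAut.ext_mat
  have h0 : HAut.mat b 2 0 = 0 := b.2.1
  have h1 : HAut.mat b 2 1 = 0 := b.2.2.1
  have h2 : HAut.mat b 2 2 = 1 := b.2.2.2
  rw [HAut.mat_mul, mat_radial hx, mat_radial (by rwa [det_rightMul]), det_rightMul]
  ext i j
  fin_cases i <;> fin_cases j <;>
    simp [rightMul, Matrix.mul_apply, Fin.sum_univ_three, dotProduct, h0, h1, h2,
      Matrix.vecHead, Matrix.vecTail] <;>
    ring

lemma measurePreserving_toLin' {M : Matrix (Fin 2) (Fin 2) ℝ} (h : M.det = 1) :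
    MeasurePreserving (Matrix.toLin' M) volume volume := by
  refine ⟨(LinearMap.continuous_of_finiteDimensional _).measurable, ?_⟩
  rw [Real.map_matrix_volume_pi_eq_smul_volume_pi (by rw [h]; exact one_ne_zero), h]
  simp

/-- A skew product: both rows undergo the same linear map of determinant 1, and for fixed rows the
last factor is translated. -/
lemma measurePreserving_rightMul (b : HAut) :
    MeasurePreserving (rightMul b) volume volume := by
  have hdet : Matrix.det !![HAut.mat b 0 0, HAut.mat b 1 0; HAut.mat b 0 1, HAut.mat b 1 1] = 1 := by
    rw [Matrix.det_fin_two_of]; linarith [mat_det b]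
  have h := measurePreserving_toLin' hdet
  have hp := h.prod h
  have hd : Measurable fun y : (Fin 2 → ℝ) × (Fin 2 → ℝ) => √(Rows.det (y, 0)) :=
    (Rows.continuous_det.comp (by fun_prop)).measurable.sqrt
  let g : (Fin 2 → ℝ) × (Fin 2 → ℝ) → (Fin 2 → ℝ) → (Fin 2 → ℝ) := fun y w =>
    w + ![(√(Rows.det (y, 0)))⁻¹ * (y.1 0 * HAut.mat b 0 2 + y.1 1 * HAut.mat b 1 2),
      (√(Rows.det (y, 0)))⁻¹ * (y.2 0 * HAut.mat b 0 2 + y.2 1 * HAut.mat b 1 2)]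
  have hg : Measurable (Function.uncurry g) := by
    refine measurable_snd.add (measurable_pi_lambda _ fun i => ?_)
    have hd' : Measurable fun z : Rows => √(Rows.det (z.1, 0)) := hd.comp measurable_fst
    fin_cases i <;> simp <;> fun_prop
  exact hp.skew_product hg (Filter.Eventually.of_forall fun y =>
    (measurePreserving_add_right volume _).map_eq)

lemma measurePreserving_rightMul_cone (b : HAut) :
    MeasurePreserving (rightMul b) (volume.restrict cone) (volume.restrict cone) := by
  have h := (measurePreserving_rightMul b).restrict_preimage measurableSet_cone
  have he : rightMul b ⁻¹' cone = cone := by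
    ext x; simp only [cone, mem_preimage, det_rightMul]
  rwa [he] at h

instance : coneMeasure.IsMulLeftInvariant := by
  refine ⟨fun a => ?_⟩
  have hm : Measurable fun x : HAut => a * x := (continuous_const_mul a).measurable
  rw [coneMeasure, Measure.map_map hm measurable_radial_inv]
  -- Inversion turns left multiplication by `a` into right multiplication by `a⁻¹`, which acts on
  -- each row separately.
  conv_rhs => rw [← (measurePreserving_rightMul_cone a⁻¹).map_eq,
    Measure.map_map measurable_radial_inv (measurePreserving_rightMul_cone a⁻¹).measurable]
  refine Measure.map_congr ?_
  filter_upwards [ae_restrict_mem measurableSet_cone] with x hx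
  simp only [Function.comp_apply]
  rw [radial_rightMul _ hx.1, mul_inv_rev, inv_inv]

lemma coneMeasure_apply {s : Set HAut} (hs : MeasurableSet s) :
    coneMeasure s = volume ({x | (radial x)⁻¹ ∈ s} ∩ cone) := by
  rw [coneMeasure, Measure.map_apply measurable_radial_inv hs, Measure.restrict_apply]
  · rfl
  · exact measurable_radial_inv hs

lemma invEntry_radial {x : Rows} (h : 0 < x.det) (i j : Fin 3) :
    invEntry (radial x)⁻¹ i j = !![(√x.det)⁻¹ * x.1.1 0, (√x.det)⁻¹ * x.1.1 1, x.2 0;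
      (√x.det)⁻¹ * x.1.2 0, (√x.det)⁻¹ * x.1.2 1, x.2 1; 0, 0, 1] i j := by
  rw [invEntry, inv_inv, mat_radial h]

/-- The determinant is at most 1 on the cone, so rows are at most as large as their normalizations
and a compact set pulls back into a bounded one. -/
instance : IsFiniteMeasureOnCompacts coneMeasure := by
  refine ⟨fun K hK => ?_⟩
  rw [coneMeasure_apply hK.isClosed.measurableSet]
  have hb (i j : Fin 3) : ∃ C, ∀ a ∈ K, |invEntry a i j| ≤ C :=
    hK.exists_bound_of_continuousOn (continuous_invEntry i j).continuousOn
  choose C hC using hb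
  set D : ℝ := ∑ i, ∑ j, |C i j| with hD
  have hCD (i j : Fin 3) : C i j ≤ D :=
    (le_abs_self _).trans ((Finset.single_le_sum (f := fun j => |C i j|)
      (fun _ _ => abs_nonneg _) (Finset.mem_univ j)).trans
      (Finset.single_le_sum (f := fun i => ∑ j, |C i j|)
        (fun _ _ => Finset.sum_nonneg fun _ _ => abs_nonneg _) (Finset.mem_univ i)))
  have hD0 : 0 ≤ D := Finset.sum_nonneg fun _ _ => Finset.sum_nonneg fun _ _ => abs_nonneg _
  refine (measure_mono (t := Metric.closedBall 0 D) ?_).trans_lt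
    Metric.isBounded_closedBall.measure_lt_top
  rintro x ⟨hx, hc⟩
  have hs : 0 < √x.det := Real.sqrt_pos.2 hc.1
  have hs1 : √x.det ≤ 1 := Real.sqrt_le_one.2 hc.2
  have hkey (i j : Fin 3) := (hC i j _ hx).trans (hCD i j)
  simp only [invEntry_radial hc.1] at hkey
  have hscale (t : ℝ) (ht : |(√x.det)⁻¹ * t| ≤ D) : |t| ≤ D := by
    have : t = √x.det * ((√x.det)⁻¹ * t) := by field_simp
    rw [this, abs_mul, abs_of_pos hs]
    exact (mul_le_of_le_one_left (abs_nonneg _) hs1).trans ht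
  rw [mem_closedBall_zero_iff, Prod.norm_def, Prod.norm_def]
  refine max_le (max_le ?_ ?_) ?_ <;> refine (pi_norm_le_iff_of_nonneg hD0).2 fun i => ?_ <;>
    rw [Real.norm_eq_abs] <;> fin_cases i
  · exact hscale _ (hkey 0 0)
  · exact hscale _ (hkey 0 1)
  · exact hscale _ (hkey 1 0)
  · exact hscale _ (hkey 1 1)
  · exact hkey 0 2
  · exact hkey 1 2

lemma coneMeasure_ne_zero : coneMeasure ≠ 0 := by
  intro h
  have h1 : coneMeasure univ = 0 := by simp [h]
  rw [coneMeasure_apply MeasurableSet.univ] at h1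
  have ho : IsOpen (Rows.det ⁻¹' Ioo 0 1) := isOpen_Ioo.preimage Rows.continuous_det
  have hn : (Rows.det ⁻¹' Ioo (0 : ℝ) 1).Nonempty := by
    refine ⟨((![1, 0], ![0, 1 / 2]), 0), ?_⟩
    simp only [mem_preimage, Rows.det]; norm_num
  have : (volume : Measure ((Fin 2 → ℝ) × (Fin 2 → ℝ))).IsOpenPosMeasure :=
    Measure.prod.instIsOpenPosMeasure
  have : (volume : Measure Rows).IsOpenPosMeasure := Measure.prod.instIsOpenPosMeasure
  refine (ho.measure_pos volume hn).ne' (measure_mono_null ?_ h1)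
  intro x hx
  exact ⟨mem_univ _, hx.1, hx.2.le⟩

lemma exists_coneMeasure_eq_smul_haar :
    ∃ c : NNReal, c ≠ 0 ∧ coneMeasure = c • (Measure.haar : Measure HAut) := by
  have h := Measure.isMulLeftInvariant_eq_smul coneMeasure (Measure.haar : Measure HAut)
  refine ⟨_, fun h0 => coneMeasure_ne_zero ?_, h⟩
  rw [h, h0, zero_smul]

lemma haar_eq_zero_of_coneMeasure {s : Set HAut} (h : coneMeasure s = 0) :
    (Measure.haar : Measure HAut) s = 0 := by
  obtain ⟨c, hc, he⟩ := exists_coneMeasure_eq_smul_haar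
  rw [he] at h
  simpa [hc] using h

lemma haar_lt_top_of_coneMeasure {s : Set HAut} (h : coneMeasure s < ⊤) :
    (Measure.haar : Measure HAut) s < ⊤ := by
  obtain ⟨c, hc, he⟩ := exists_coneMeasure_eq_smul_haar
  rw [he, Measure.smul_apply, ENNReal.smul_def, smul_eq_mul] at h
  by_contra hcon
  rw [not_lt, top_le_iff] at hcon
  rw [hcon, ENNReal.mul_top (by simpa using hc)] at h
  exact lt_irrefl _ h

/-! ### Finiteness and positivity of the mass of the fundamental set. -/

lemma mem_fundamentalSet_iff (a : HAut) : a ∈ fundamentalSet ↔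
    (invEntry a 1 0 ^ 2 + invEntry a 1 1 ^ 2 ≤ invEntry a 0 0 ^ 2 + invEntry a 0 1 ^ 2 ∧
      |invEntry a 0 0 * invEntry a 1 0 + invEntry a 0 1 * invEntry a 1 1| ≤
        (invEntry a 1 0 ^ 2 + invEntry a 1 1 ^ 2) / 2) ∧
      invEntry a 0 2 ∈ Ico (0 : ℝ) 1 ∧ invEntry a 1 2 ∈ Ico (0 : ℝ) 1 := by
  rw [← linPart_smul_I_mem_fd_iff]; rfl

lemma measurableSet_fundamentalSet : MeasurableSet fundamentalSet := by
  have h (i j : Fin 3) := (continuous_invEntry i j).measurable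
  have he : fundamentalSet = {a | (invEntry a 1 0 ^ 2 + invEntry a 1 1 ^ 2 ≤
        invEntry a 0 0 ^ 2 + invEntry a 0 1 ^ 2 ∧
      |invEntry a 0 0 * invEntry a 1 0 + invEntry a 0 1 * invEntry a 1 1| ≤
        (invEntry a 1 0 ^ 2 + invEntry a 1 1 ^ 2) / 2) ∧
      invEntry a 0 2 ∈ Ico (0 : ℝ) 1 ∧ invEntry a 1 2 ∈ Ico (0 : ℝ) 1} :=
    ext mem_fundamentalSet_iff
  rw [he]
  have m1 : MeasurableSet {a | invEntry a 1 0 ^ 2 + invEntry a 1 1 ^ 2 ≤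
      invEntry a 0 0 ^ 2 + invEntry a 0 1 ^ 2} :=
    measurableSet_le (by fun_prop) (by fun_prop)
  have m2 : MeasurableSet {a |
      |invEntry a 0 0 * invEntry a 1 0 + invEntry a 0 1 * invEntry a 1 1| ≤
        (invEntry a 1 0 ^ 2 + invEntry a 1 1 ^ 2) / 2} :=
    measurableSet_le (Measurable.abs (by fun_prop)) (by fun_prop)
  exact (m1.inter m2).inter ((h 0 2 measurableSet_Ico).inter (h 1 2 measurableSet_Ico))

/-- The cone over the pairs of rows `(r, s)` with `(r; s) · i` in the fundamental domain. -/
def siegelCone : Set ((Fin 2 → ℝ) × (Fin 2 → ℝ)) :=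
  {y | Rows.det (y, 0) ∈ Ioc (0 : ℝ) 1 ∧
    y.1 0 * y.2 0 + y.1 1 * y.2 1 ∈
      Icc (-((y.2 0 ^ 2 + y.2 1 ^ 2) / 2)) ((y.2 0 ^ 2 + y.2 1 ^ 2) / 2) ∧
    y.2 0 ^ 2 + y.2 1 ^ 2 ≤ 2}

/-- With `N = |s|²`, the linear map `r ↦ (det (r, s), r · s)` has determinant `N` and sends the
fiber into a box of area `N`. The fiber area thus stays bounded by 1 even in the cusp `N → 0`. -/
lemma volume_siegelCone_fiber_le (s : Fin 2 → ℝ) :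
    volume ((fun r => (r, s)) ⁻¹' siegelCone) ≤
      (Metric.closedBall (0 : Fin 2 → ℝ) 2).indicator 1 s := by
  by_cases hs : 0 < s 0 ^ 2 + s 1 ^ 2 ∧ s 0 ^ 2 + s 1 ^ 2 ≤ 2
  · obtain ⟨h0, h2⟩ := hs
    rw [indicator_of_mem, Pi.one_apply]
    · set M : Matrix (Fin 2) (Fin 2) ℝ := !![s 1, -s 0; s 0, s 1] with hM
      set N := s 0 ^ 2 + s 1 ^ 2 with hN
      have hdet : LinearMap.det (Matrix.toLin' M) = N := by
        rw [LinearMap.det_toLin', hM, Matrix.det_fin_two_of]; ring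
      let box : Fin 2 → Set ℝ := ![Ioc 0 1, Icc (-(N / 2)) (N / 2)]
      have hsub : (fun r => (r, s)) ⁻¹' siegelCone ⊆
          (Matrix.toLin' M) ⁻¹' (univ.pi box) := by
        rintro r ⟨h1, h2, -⟩ i -
        have e0 : Matrix.toLin' M r 0 = Rows.det ((r, s), 0) := by
          simp [hM, Rows.det, Matrix.mulVec, dotProduct, Fin.sum_univ_two]; ring
        have e1 : Matrix.toLin' M r 1 = r 0 * s 0 + r 1 * s 1 := by
          simp [hM, Matrix.mulVec, dotProduct, Fin.sum_univ_two]; ring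
        fin_cases i
        · exact e0 ▸ h1
        · exact e1 ▸ h2
      refine (measure_mono hsub).trans ?_
      rw [Measure.addHaar_preimage_linearMap _ (by rw [hdet]; exact h0.ne'), hdet,
        volume_pi_pi, Fin.prod_univ_two]
      simp only [box, Matrix.cons_val_zero, Matrix.cons_val_one, Real.volume_Ioc,
        Real.volume_Icc]
      rw [← ENNReal.ofReal_mul (by norm_num), ← ENNReal.ofReal_mul (abs_nonneg _),
        abs_of_pos (inv_pos.2 h0), ENNReal.ofReal_le_one]
      have : N⁻¹ * N = 1 := inv_mul_cancel₀ h0.ne'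
      linarith
    · rw [mem_closedBall_zero_iff]
      refine (pi_norm_le_iff_of_nonneg (by norm_num)).2 fun i => ?_
      rw [Real.norm_eq_abs]
      fin_cases i
      · exact abs_le_of_sq_le_sq (by simp; nlinarith [sq_nonneg (s 1)]) (by norm_num)
      · exact abs_le_of_sq_le_sq (by simp; nlinarith [sq_nonneg (s 0)]) (by norm_num)
  · have he : (fun r => (r, s)) ⁻¹' siegelCone = ∅ := by
      refine eq_empty_of_forall_notMem ?_
      rintro r ⟨h1, -, h3⟩
      refine hs ⟨?_, h3⟩
      by_contra hcon
      have e0 : s 0 = 0 := by nlinarith [sq_nonneg (s 0), sq_nonneg (s 1)]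
      have e1 : s 1 = 0 := by nlinarith [sq_nonneg (s 0), sq_nonneg (s 1)]
      simp [Rows.det, e0, e1] at h1
    rw [he, measure_empty]; exact zero_le

lemma measurableSet_siegelCone : MeasurableSet siegelCone := by
  have hd : Continuous fun y : (Fin 2 → ℝ) × (Fin 2 → ℝ) => Rows.det (y, 0) :=
    Rows.continuous_det.comp (by fun_prop)
  have h1 : Measurable fun y : (Fin 2 → ℝ) × (Fin 2 → ℝ) =>
      y.1 0 * y.2 0 + y.1 1 * y.2 1 := by fun_prop
  have h2 : Measurable fun y : (Fin 2 → ℝ) × (Fin 2 → ℝ) => y.2 0 ^ 2 + y.2 1 ^ 2 := by fun_prop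
  exact (hd.measurable measurableSet_Ioc).inter
    (((measurableSet_le (h2.div_const 2).neg h1).inter (measurableSet_le h1 (h2.div_const 2))).inter
      (measurableSet_le h2 measurable_const))

lemma volume_siegelCone_lt_top : volume siegelCone < ⊤ := by
  rw [Measure.volume_eq_prod, Measure.prod_apply_symm measurableSet_siegelCone]
  refine (lintegral_mono volume_siegelCone_fiber_le).trans_lt ?_
  rw [lintegral_indicator_one measurableSet_closedBall]
  exact Metric.isBounded_closedBall.measure_lt_top

lemma coneMeasure_fundamentalSet_lt_top : coneMeasure fundamentalSet < ⊤ := by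
  rw [coneMeasure_apply measurableSet_fundamentalSet]
  refine (measure_mono (t := siegelCone ×ˢ Metric.closedBall 0 1) ?_).trans_lt ?_
  · rintro x ⟨hx, hc⟩
    rw [mem_ofPred_eq, mem_fundamentalSet_iff] at hx
    simp only [invEntry_radial hc.1] at hx
    obtain ⟨⟨h1, h2⟩, h3, h4⟩ := hx
    have hpos : 0 < Rows.det x := hc.1
    set t := (√(Rows.det x))⁻¹ with ht
    have htt : t ^ 2 * Rows.det x = 1 := by
      rw [ht, inv_pow, Real.sq_sqrt hpos.le, inv_mul_cancel₀ hpos.ne']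
    have ht0 : 0 < t ^ 2 := by by_contra hcon; nlinarith
    set r0 := x.1.1 0 with hr0
    set r1 := x.1.1 1 with hr1
    set s0 := x.1.2 0 with hs0
    set s1 := x.1.2 1 with hs1
    simp at h1 h2 h3 h4
    have h1' : s0 ^ 2 + s1 ^ 2 ≤ r0 ^ 2 + r1 ^ 2 := by
      refine le_of_mul_le_mul_left ?_ ht0
      linarith
    have h2' : |r0 * s0 + r1 * s1| ≤ (s0 ^ 2 + s1 ^ 2) / 2 := by
      refine le_of_mul_le_mul_left ?_ ht0
      have he : t * r0 * (t * s0) + t * r1 * (t * s1) = t ^ 2 * (r0 * s0 + r1 * s1) := by ring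
      rw [he, abs_mul, abs_of_pos ht0] at h2
      linarith
    have hdet : Rows.det x = r0 * s1 - r1 * s0 := rfl
    have hid : (r0 ^ 2 + r1 ^ 2) * (s0 ^ 2 + s1 ^ 2) =
        (r0 * s0 + r1 * s1) ^ 2 + Rows.det x ^ 2 := by rw [hdet]; ring
    have hd1 : Rows.det x ^ 2 ≤ 1 := by nlinarith [hc.2]
    have hsq : (r0 * s0 + r1 * s1) ^ 2 ≤ ((s0 ^ 2 + s1 ^ 2) / 2) ^ 2 :=
      sq_le_sq' (abs_le.1 h2').1 (abs_le.1 h2').2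
    have hN0 : 0 ≤ s0 ^ 2 + s1 ^ 2 := by positivity
    refine ⟨⟨hc, abs_le.1 h2', ?_⟩, ?_⟩
    -- Lagrange's identity gives `N² ≤ N² / 4 + 1` for `N = s0² + s1²`; the bound 2 is not sharp.
    · change s0 ^ 2 + s1 ^ 2 ≤ 2
      nlinarith [mul_le_mul_of_nonneg_right h1' hN0]
    · rw [mem_closedBall_zero_iff]
      refine (pi_norm_le_iff_of_nonneg (by norm_num)).2 fun i => ?_
      rw [Real.norm_eq_abs, abs_le]
      fin_cases i
      · exact ⟨by simp; linarith [h3.1], h3.2.le⟩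
      · exact ⟨by simp; linarith [h4.1], h4.2.le⟩
  · rw [Measure.volume_eq_prod, Measure.prod_prod]
    exact ENNReal.mul_lt_top volume_siegelCone_lt_top
      Metric.isBounded_closedBall.measure_lt_top

lemma haar_fundamentalSet_lt_top : (Measure.haar : Measure HAut) fundamentalSet < ⊤ :=
  haar_lt_top_of_coneMeasure coneMeasure_fundamentalSet_lt_top

/-- The elements of the group with `h` close to the identity. -/
def nearIdentity (κ : ℝ) : Set HAut :=
  {a | |invEntry a 0 0 - 1| < κ ∧ |invEntry a 0 1| < κ ∧ |invEntry a 1 0| < κ ∧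
    |invEntry a 1 1 - 1| < κ}

lemma isOpen_nearIdentity (κ : ℝ) : IsOpen (nearIdentity κ) := by
  have h (i j : Fin 3) := continuous_invEntry i j
  refine IsOpen.inter ?_ (IsOpen.inter ?_ (IsOpen.inter ?_ ?_))
  · exact isOpen_lt ((h 0 0).sub continuous_const).abs continuous_const
  · exact isOpen_lt (h 0 1).abs continuous_const
  · exact isOpen_lt (h 1 0).abs continuous_const
  · exact isOpen_lt ((h 1 1).sub continuous_const).abs continuous_const

lemma haar_fundamentalSet_inter_nearIdentity_pos {κ : ℝ} (hκ : 0 < κ) :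
    0 < (Measure.haar : Measure HAut) (fundamentalSet ∩ nearIdentity κ) := by
  have h (i j : Fin 3) := continuous_invEntry i j
  set U : Set HAut := {a | (invEntry a 1 0 ^ 2 + invEntry a 1 1 ^ 2 <
        invEntry a 0 0 ^ 2 + invEntry a 0 1 ^ 2 ∧
      |invEntry a 0 0 * invEntry a 1 0 + invEntry a 0 1 * invEntry a 1 1| <
        (invEntry a 1 0 ^ 2 + invEntry a 1 1 ^ 2) / 2) ∧
      invEntry a 0 2 ∈ Ioo (0 : ℝ) 1 ∧ invEntry a 1 2 ∈ Ioo (0 : ℝ) 1} with hU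
  have hUo : IsOpen U := by
    have o1 : IsOpen {a | invEntry a 1 0 ^ 2 + invEntry a 1 1 ^ 2 <
        invEntry a 0 0 ^ 2 + invEntry a 0 1 ^ 2} :=
      isOpen_lt (by fun_prop) (by fun_prop)
    have o2 : IsOpen {a |
        |invEntry a 0 0 * invEntry a 1 0 + invEntry a 0 1 * invEntry a 1 1| <
          (invEntry a 1 0 ^ 2 + invEntry a 1 1 ^ 2) / 2} :=
      isOpen_lt (Continuous.abs (by fun_prop)) (by fun_prop)
    exact (o1.inter o2).inter ((isOpen_Ioo.preimage (h 0 2)).inter (isOpen_Ioo.preimage (h 1 2)))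
  have hne : (U ∩ nearIdentity κ).Nonempty := by
    -- The identity sends `i` to the boundary of the domain, so a small diagonal stretch moves it
    -- into the interior; `w = (1/2, 1/2)` is interior as well.
    obtain ⟨s, hs0, hs1⟩ : ∃ s : ℝ, 0 < s ∧ s < κ := exists_between hκ
    have hp : (0 : ℝ) < 1 + s := by linarith
    have hi : (1 + s)⁻¹ < 1 := inv_lt_one_of_one_lt₀ (by linarith)
    have hi0 : 0 < (1 + s)⁻¹ := inv_pos.2 hp
    have hm : (1 + s) * (1 + s)⁻¹ = 1 := mul_inv_cancel₀ hp.ne'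
    refine ⟨(ofRows ![1 + s, 0] ![0, (1 + s)⁻¹] ![1 / 2, 1 / 2] (by simp [hm]))⁻¹, ?_, ?_⟩
    · simp only [hU, mem_ofPred_eq, invEntry, inv_inv, mat_ofRows]
      simp
      rw [← inv_pow]
      refine ⟨⟨by nlinarith, by positivity⟩, by norm_num⟩
    · simp only [nearIdentity, mem_ofPred_eq, invEntry, inv_inv, mat_ofRows]
      simp
      refine ⟨by rwa [abs_of_pos hs0], hκ, ?_⟩
      rw [abs_lt]; constructor <;> nlinarith
  refine ((hUo.inter (isOpen_nearIdentity κ)).measure_pos _ hne).trans_le (measure_mono ?_)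
  rintro a ⟨⟨⟨h1, h2⟩, h3, h4⟩, ha⟩
  exact ⟨(mem_fundamentalSet_iff a).2 ⟨⟨h1.le, h2.le⟩, ⟨h3.1.le, h3.2⟩, ⟨h4.1.le, h4.2⟩⟩, ha⟩

lemma haar_fundamentalSet_pos : 0 < (Measure.haar : Measure HAut) fundamentalSet :=
  (haar_fundamentalSet_inter_nearIdentity_pos one_pos).trans_le (measure_mono inter_subset_left)

/-! ### Null sets of translations and the automorphisms to be avoided. -/

lemma volume_line_eq_zero {p q : ℝ} (h : p ≠ 0 ∨ q ≠ 0) (k : ℝ) :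
    volume {w : Fin 2 → ℝ | w 0 * p + w 1 * q = k} = 0 := by
  let f : (Fin 2 → ℝ) →ₗ[ℝ] ℝ :=
    p • LinearMap.proj 0 + q • LinearMap.proj 1
  have hf (w : Fin 2 → ℝ) : f w = w 0 * p + w 1 * q := by simp [f]; ring
  by_cases he : {w : Fin 2 → ℝ | w 0 * p + w 1 * q = k}.Nonempty
  · obtain ⟨w₀, hw₀⟩ := he
    have hset : {w : Fin 2 → ℝ | w 0 * p + w 1 * q = k} =
        (AffineSubspace.mk' w₀ (LinearMap.ker f) : Set (Fin 2 → ℝ)) := by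
      ext w
      simp only [mem_ofPred_eq, SetLike.mem_coe, AffineSubspace.mem_mk', vsub_eq_sub,
        LinearMap.mem_ker]
      rw [mem_ofPred_eq] at hw₀
      rw [map_sub, hf, hf, hw₀, sub_eq_zero]
    rw [hset]
    refine Measure.addHaar_affineSubspace _ _ fun htop => ?_
    have hdir := congrArg AffineSubspace.direction htop
    rw [AffineSubspace.direction_mk', AffineSubspace.direction_top, LinearMap.ker_eq_top] at hdir
    have h0 := hf ![1, 0]
    have h1 := hf ![0, 1]
    rw [hdir] at h0 h1
    simp at h0 h1
    rcases h with h | h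
    · exact h h0.symm
    · exact h h1.symm
  · rw [not_nonempty_iff_eq_empty.1 he, measure_empty]

lemma haar_invEntry_eq_zero {p q : ℝ} (h : p ≠ 0 ∨ q ≠ 0) (k : ℝ) :
    (Measure.haar : Measure HAut) {a | invEntry a 0 2 * p + invEntry a 1 2 * q = k} = 0 := by
  have hc (i j : Fin 3) := (continuous_invEntry i j).measurable
  refine haar_eq_zero_of_coneMeasure ?_
  rw [coneMeasure_apply (measurableSet_eq_fun (by fun_prop) measurable_const)]
  refine measure_mono_null
    (t := univ ×ˢ {w : Fin 2 → ℝ | w 0 * p + w 1 * q = k}) ?_ ?_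
  · rintro x ⟨hx, hc⟩
    rw [mem_ofPred_eq, mem_ofPred_eq, invEntry_radial hc.1, invEntry_radial hc.1] at hx
    exact ⟨mem_univ _, hx⟩
  · rw [Measure.volume_eq_prod, Measure.prod_prod, volume_line_eq_zero h, mul_zero]

/-- The normalized Haar measure on the fundamental set. -/
noncomputable def fundamentalMeasure : Measure HAut :=
  ProbabilityTheory.cond (Measure.haar : Measure HAut) fundamentalSet

instance : IsProbabilityMeasure fundamentalMeasure :=
  ProbabilityTheory.cond_isProbabilityMeasure_of_finite haar_fundamentalSet_pos.ne'
    haar_fundamentalSet_lt_top.ne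

lemma measurable_toXH : Measurable toXH := fun _ h => h

/-- Lower bounds pass to `muH` through this inequality, which needs no measurability of `s`. -/
lemma fundamentalMeasure_preimage_le (s : Set XH) :
    fundamentalMeasure (toXH ⁻¹' s) ≤ muH s :=
  Measure.le_map_apply measurable_toXH.aemeasurable s

/-- The automorphisms `a` for which some nonzero integer point `(m, n)` gives a point of the lattice
with flat part in a box of size `R` and central part in `[0, η)` modulo the integers. -/
def badSet (R η : ℝ) : Set HAut :=
  ⋃ (m : ℤ) (n : ℤ) (k : ℤ) (_ : (m : ℝ) ≠ 0 ∨ (n : ℝ) ≠ 0),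
    {a | (|invEntry a 0 0 * m + invEntry a 1 0 * n| < R ∧
      |invEntry a 0 1 * m + invEntry a 1 1 * n| < R) ∧
      invEntry a 0 2 * m + invEntry a 1 2 * n - k ∈ Ico 0 η}

lemma mem_badSet_iff {R η : ℝ} {a : HAut} : a ∈ badSet R η ↔
    ∃ m n k : ℤ, ((m : ℝ) ≠ 0 ∨ (n : ℝ) ≠ 0) ∧
      (|invEntry a 0 0 * m + invEntry a 1 0 * n| < R ∧
      |invEntry a 0 1 * m + invEntry a 1 1 * n| < R) ∧
      invEntry a 0 2 * m + invEntry a 1 2 * n - k ∈ Ico 0 η := by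
  simp only [badSet, mem_iUnion, exists_prop, mem_ofPred_eq]

lemma measurableSet_badSet (R η : ℝ) : MeasurableSet (badSet R η) := by
  have h (i j : Fin 3) := (continuous_invEntry i j).measurable
  refine MeasurableSet.iUnion fun m => MeasurableSet.iUnion fun n => MeasurableSet.iUnion fun k =>
    MeasurableSet.iUnion fun _ => ?_
  have h0 : Measurable fun a => invEntry a 0 0 * m + invEntry a 1 0 * n := by fun_prop
  have h1 : Measurable fun a => invEntry a 0 1 * m + invEntry a 1 1 * n := by fun_prop
  have h2 : Measurable fun a => invEntry a 0 2 * m + invEntry a 1 2 * n - k := by fun_prop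
  exact ((measurableSet_lt h0.abs measurable_const).inter
    (measurableSet_lt h1.abs measurable_const)).inter (h2 measurableSet_Ico)

lemma badSet_mono {R η η' : ℝ} (h : η ≤ η') : badSet R η ⊆ badSet R η' := by
  intro a ha
  obtain ⟨m, n, k, h0, h1, h2⟩ := mem_badSet_iff.1 ha
  exact mem_badSet_iff.2 ⟨m, n, k, h0, h1, h2.1, h2.2.trans_le h⟩

/-- The automorphisms that give some nonzero integer point an integral central part. -/
def integralSet : Set HAut :=
  ⋃ (m : ℤ) (n : ℤ) (k : ℤ) (_ : (m : ℝ) ≠ 0 ∨ (n : ℝ) ≠ 0),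
    {a | invEntry a 0 2 * m + invEntry a 1 2 * n = k}

lemma haar_integralSet : (Measure.haar : Measure HAut) integralSet = 0 := by
  simp only [integralSet, measure_iUnion_null_iff]
  exact fun m n k h => haar_invEntry_eq_zero h k

/-- Inverting `h` bounds `m` and `n`, and then `k`, so only finitely many triples matter; for each
one the nonzero number `w · (m, n) - k` eventually leaves the shrinking interval. -/
lemma eventually_notMem_badSet (R : ℝ) {a : HAut} (ha : a ∉ integralSet) :
    ∀ᶠ i : ℕ in Filter.atTop, a ∉ badSet R (1 / ((i : ℝ) + 2)) := by
  have hd := invEntry_det a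
  set C := (|invEntry a 1 1| + |invEntry a 1 0| + |invEntry a 0 1| + |invEntry a 0 0|) * |R|
    with hC
  set D := |invEntry a 0 2| * C + |invEntry a 1 2| * C + 1 with hD
  have hC0 : 0 ≤ C := by positivity
  have hD0 : 0 ≤ D := by positivity
  set N : ℤ := ⌈C + D⌉ with hN
  have hNC : C + D ≤ N := Int.le_ceil _
  set Q : Finset (ℤ × ℤ × ℤ) := Finset.Icc (-N) N ×ˢ Finset.Icc (-N) N ×ˢ Finset.Icc (-N) N with hQ
  have hmem (x : ℤ) (hx : |(x : ℝ)| ≤ C + D) : x ∈ Finset.Icc (-N) N := by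
    rw [Finset.mem_Icc, ← abs_le]
    exact_mod_cast hx.trans hNC
  have hev : ∀ᶠ i : ℕ in Filter.atTop, ∀ q ∈ Q, ((q.1 : ℝ) ≠ 0 ∨ (q.2.1 : ℝ) ≠ 0) →
      invEntry a 0 2 * q.1 + invEntry a 1 2 * q.2.1 - q.2.2 ∉ Ico 0 (1 / ((i : ℝ) + 2)) := by
    rw [Filter.eventually_all_finset]
    rintro ⟨m, n, k⟩ -
    by_cases h0 : (m : ℝ) ≠ 0 ∨ (n : ℝ) ≠ 0
    swap
    · exact Filter.Eventually.of_forall fun _ h => absurd h h0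
    have hne : invEntry a 0 2 * m + invEntry a 1 2 * n - k ≠ 0 := by
      intro h
      refine ha ?_
      simp only [integralSet, mem_iUnion]
      exact ⟨m, n, k, h0, sub_eq_zero.1 h⟩
    rcases hne.lt_or_gt with hlt | hgt
    · exact Filter.Eventually.of_forall fun _ _ h => hlt.not_ge h.1
    · obtain ⟨i₀, hi₀⟩ := exists_nat_one_div_lt hgt
      filter_upwards [Filter.eventually_ge_atTop i₀] with i hi _ h
      refine (h.2.trans_le ?_).not_gt hi₀
      have : (i₀ : ℝ) ≤ i := by exact_mod_cast hi
      exact one_div_le_one_div_of_le (by positivity) (by linarith)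
  filter_upwards [hev] with i hi hbad
  obtain ⟨m, n, k, h0, ⟨h1, h2⟩, h3⟩ := mem_badSet_iff.1 hbad
  have hR : |invEntry a 0 0 * m + invEntry a 1 0 * n| ≤ |R| := h1.le.trans (le_abs_self R)
  have hR' : |invEntry a 0 1 * m + invEntry a 1 1 * n| ≤ |R| := h2.le.trans (le_abs_self R)
  have hR0 := abs_nonneg R
  have hm : |(m : ℝ)| ≤ C := by
    have he : (m : ℝ) = invEntry a 1 1 * (invEntry a 0 0 * m + invEntry a 1 0 * n) -
        invEntry a 1 0 * (invEntry a 0 1 * m + invEntry a 1 1 * n) := by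
      linear_combination -(m : ℝ) * hd
    have h := abs_sub (invEntry a 1 1 * (invEntry a 0 0 * m + invEntry a 1 0 * n))
      (invEntry a 1 0 * (invEntry a 0 1 * m + invEntry a 1 1 * n))
    rw [← he, abs_mul, abs_mul] at h
    nlinarith [mul_le_mul_of_nonneg_left hR (abs_nonneg (invEntry a 1 1)),
      mul_le_mul_of_nonneg_left hR' (abs_nonneg (invEntry a 1 0)),
      mul_nonneg (abs_nonneg (invEntry a 0 1)) hR0, mul_nonneg (abs_nonneg (invEntry a 0 0)) hR0]
  have hn : |(n : ℝ)| ≤ C := by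
    have he : (n : ℝ) = invEntry a 0 0 * (invEntry a 0 1 * m + invEntry a 1 1 * n) -
        invEntry a 0 1 * (invEntry a 0 0 * m + invEntry a 1 0 * n) := by
      linear_combination -(n : ℝ) * hd
    have h := abs_sub (invEntry a 0 0 * (invEntry a 0 1 * m + invEntry a 1 1 * n))
      (invEntry a 0 1 * (invEntry a 0 0 * m + invEntry a 1 0 * n))
    rw [← he, abs_mul, abs_mul] at h
    nlinarith [mul_le_mul_of_nonneg_left hR (abs_nonneg (invEntry a 0 1)),
      mul_le_mul_of_nonneg_left hR' (abs_nonneg (invEntry a 0 0)),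
      mul_nonneg (abs_nonneg (invEntry a 1 1)) hR0, mul_nonneg (abs_nonneg (invEntry a 1 0)) hR0]
  have hk : |(k : ℝ)| ≤ D := by
    have hi1 : 1 / ((i : ℝ) + 2) ≤ 1 := by
      rw [div_le_one (by positivity)]; linarith [(Nat.cast_nonneg i : (0 : ℝ) ≤ i)]
    have hA : |invEntry a 0 2 * m| ≤ |invEntry a 0 2| * C := by
      rw [abs_mul]; exact mul_le_mul_of_nonneg_left hm (abs_nonneg _)
    have hB : |invEntry a 1 2 * n| ≤ |invEntry a 1 2| * C := by
      rw [abs_mul]; exact mul_le_mul_of_nonneg_left hn (abs_nonneg _)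
    rw [abs_le] at hA hB ⊢
    constructor <;> linarith [h3.1, h3.2]
  refine hi (m, n, k) ?_ h0 h3
  simp only [hQ, Finset.mem_product]
  exact ⟨hmem m (by linarith), hmem n (by linarith), hmem k (by linarith)⟩

lemma exists_fundamentalMeasure_badSet_le (R : ℝ) :
    ∃ η : ℝ, 0 < η ∧ η ≤ 1 / 2 ∧ fundamentalMeasure (badSet R η) ≤ 1 / 2 := by
  have hanti : Antitone fun i : ℕ => badSet R (1 / ((i : ℝ) + 2)) := by
    intro i j hij
    refine badSet_mono (one_div_le_one_div_of_le (by positivity) ?_)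
    have : (i : ℝ) ≤ j := by exact_mod_cast hij
    linarith
  have ht := tendsto_measure_iInter_atTop (μ := fundamentalMeasure)
    (fun i : ℕ => (measurableSet_badSet R (1 / ((i : ℝ) + 2))).nullMeasurableSet) hanti
    ⟨0, measure_ne_top _ _⟩
  have hnull : fundamentalMeasure (⋂ i : ℕ, badSet R (1 / ((i : ℝ) + 2))) = 0 := by
    refine measure_mono_null (t := integralSet) (fun a ha => ?_)
      (ProbabilityTheory.cond_absolutelyContinuous haar_integralSet)
    by_contra hcon
    obtain ⟨i, hi⟩ := (eventually_notMem_badSet R hcon).exists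
    exact hi (mem_iInter.1 ha i)
  rw [hnull] at ht
  obtain ⟨i, hi⟩ := (ht.eventually (gt_mem_nhds (show (0 : ENNReal) < 1 / 2 by simp))).exists
  -- The shift by 2 ensures `η ≤ 1 / 2`, so that the gaps of the comb are at least as long as its
  -- teeth.
  refine ⟨1 / ((i : ℝ) + 2), by positivity, ?_, hi.le⟩
  exact one_div_le_one_div_of_le (by norm_num) (by linarith [(Nat.cast_nonneg i : (0 : ℝ) ≤ i)])

/-! ### Combs and their distance from cylinders. -/

/-- The union of the intervals `[j + α, j + β)` for `p ≤ j < q`. -/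
def blocks (p q : ℕ) (α β : ℝ) : Set ℝ := ⋃ j ∈ Finset.Ico p q, Ico ((j : ℝ) + α) (j + β)

lemma mem_blocks_iff {p q : ℕ} {α β x : ℝ} :
    x ∈ blocks p q α β ↔ ∃ j : ℕ, (p ≤ j ∧ j < q) ∧ (j : ℝ) + α ≤ x ∧ x < j + β := by
  simp only [blocks, mem_iUnion, Finset.mem_Ico, exists_prop, mem_Ico]

lemma measurableSet_blocks (p q : ℕ) (α β : ℝ) : MeasurableSet (blocks p q α β) :=
  Finset.measurableSet_biUnion _ fun _ _ => measurableSet_Ico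

lemma eq_of_mem_unit_intervals {i j : ℕ} {x : ℝ} (h1 : (i : ℝ) ≤ x) (h2 : x < i + 1)
    (h3 : (j : ℝ) ≤ x) (h4 : x < j + 1) : i = j := by
  have h5 : i < j + 1 := by exact_mod_cast h1.trans_lt h4
  have h6 : j < i + 1 := by exact_mod_cast h3.trans_lt h2
  omega

lemma volume_blocks (p q : ℕ) {α β : ℝ} (hα : 0 ≤ α) (hβ : β ≤ 1) :
    volume (blocks p q α β) = ((q - p : ℕ) : ENNReal) * ENNReal.ofReal (β - α) := by
  rw [blocks, measure_biUnion_finset]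
  · simp
  · intro i _ j _ hij
    refine disjoint_left.2 fun x hx hy => hij ?_
    exact eq_of_mem_unit_intervals (x := x) (by linarith [hx.1]) (by linarith [hx.2])
      (by linarith [hy.1]) (by linarith [hy.2])
  · exact fun _ _ => measurableSet_Ico

/-- An interval reaching both below `J` and up to `2J` or beyond contains the `J` gaps of the middle
third; otherwise it misses all teeth of the first or of the last third. -/
lemma volume_symmDiff_blocks_ge {I : Set ℝ} (hI : I.OrdConnected) (J : ℕ) {η : ℝ} (h0 : 0 ≤ η)
    (hη : η ≤ 1 / 2) :
    (J : ENNReal) * ENNReal.ofReal η ≤ volume (symmDiff I (blocks 0 (3 * J) 0 η)) := by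
  by_cases h1 : ∃ x ∈ I, x < J
  · by_cases h2 : ∃ y ∈ I, 2 * J ≤ y
    · obtain ⟨x, hx, hxJ⟩ := h1
      obtain ⟨y, hy, hyJ⟩ := h2
      have hv := volume_blocks J (2 * J) h0 le_rfl
      rw [show 2 * J - J = J by omega] at hv
      refine le_trans ?_ (hv.symm.le.trans (measure_mono ?_))
      · gcongr; linarith
      · intro z hz
        obtain ⟨j, ⟨hj1, hj2⟩, hz1, hz2⟩ := mem_blocks_iff.1 hz
        have hj1' : (J : ℝ) ≤ j := by exact_mod_cast hj1
        have hj2' : (j : ℝ) + 1 ≤ 2 * J := by exact_mod_cast hj2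
        refine Or.inl ⟨hI.out hx hy ⟨by linarith, by linarith⟩, fun hzT => ?_⟩
        obtain ⟨i, -, hi1, hi2⟩ := mem_blocks_iff.1 hzT
        have := eq_of_mem_unit_intervals (i := i) (j := j) (x := z) (by linarith) (by linarith)
          (by linarith) (by linarith)
        subst this
        linarith
    · have hv := volume_blocks (2 * J) (3 * J) le_rfl (show η ≤ 1 by linarith)
      rw [show 3 * J - 2 * J = J by omega, sub_zero] at hv
      refine hv.symm.le.trans (measure_mono fun z hz => ?_)
      obtain ⟨j, ⟨hj1, hj2⟩, hz1, hz2⟩ := mem_blocks_iff.1 hz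
      refine Or.inr ⟨mem_blocks_iff.2 ⟨j, ⟨Nat.zero_le _, hj2⟩, hz1, hz2⟩, fun hzI => h2 ⟨z, hzI, ?_⟩⟩
      have : 2 * (J : ℝ) ≤ j := by exact_mod_cast hj1
      linarith
  · have hv := volume_blocks 0 J le_rfl (show η ≤ 1 by linarith)
    rw [Nat.sub_zero, sub_zero] at hv
    refine hv.symm.le.trans (measure_mono fun z hz => ?_)
    obtain ⟨j, ⟨hj1, hj2⟩, hz1, hz2⟩ := mem_blocks_iff.1 hz
    refine Or.inr ⟨mem_blocks_iff.2 ⟨j, ⟨hj1, by omega⟩, hz1, hz2⟩, fun hzI => h1 ⟨z, hzI, ?_⟩⟩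
    have : (j : ℝ) + 1 ≤ J := by exact_mod_cast hj2
    linarith

lemma volume_symmDiff_cylinder_ge {A : Set Plane} (hA : MeasurableSet A) {C : Set Space}
    (hC : IsCylinder C) (J : ℕ) {η : ℝ} (h0 : 0 ≤ η) (hη : η ≤ 1 / 2) :
    volume A * ((J : ENNReal) * ENNReal.ofReal η) ≤
      volume (symmDiff C (A ×ˢ blocks 0 (3 * J) 0 η)) := by
  obtain ⟨B, I, hB, hI, rfl⟩ := hC
  set T := blocks 0 (3 * J) 0 η with hT
  have hTm : MeasurableSet T := measurableSet_blocks _ _ _ _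
  have hTv : (J : ENNReal) * ENNReal.ofReal η ≤ volume T := by
    rw [hT, volume_blocks _ _ le_rfl (by linarith), sub_zero]
    gcongr; omega
  -- Over `A ∩ B` the fibers differ by an interval against a comb, and over `A \ B` by the entire
  -- comb.
  have hsub : (A ∩ B) ×ˢ symmDiff I T ∪ (A \ B) ×ˢ T ⊆ symmDiff (B ×ˢ I) (A ×ˢ T) := by
    rintro ⟨p, t⟩ (⟨⟨h1, h2⟩, h3⟩ | ⟨⟨h1, h2⟩, h3⟩)
    · rcases h3 with ⟨h3, h4⟩ | ⟨h3, h4⟩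
      · exact Or.inl ⟨⟨h2, h3⟩, fun h => h4 h.2⟩
      · exact Or.inr ⟨⟨h1, h3⟩, fun h => h4 h.2⟩
    · exact Or.inr ⟨⟨h1, h3⟩, fun h => h2 h.1⟩
  have hdisj : Disjoint ((A ∩ B) ×ˢ symmDiff I T) ((A \ B) ×ˢ T) :=
    disjoint_left.2 fun x h1 h2 => h2.1.2 h1.1.2
  refine le_trans ?_ (measure_mono hsub)
  rw [measure_union hdisj ((hA.diff hB).prod hTm), Measure.volume_eq_prod, Measure.prod_prod,
    Measure.prod_prod, ← measure_inter_add_sdiff A hB, add_mul]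
  gcongr
  exact volume_symmDiff_blocks_ge hI J h0 hη

/-! ### Lattices that miss a given set. -/

lemma toXH_mem_missing_prod_blocks {A : Set Plane} {R η : ℝ} (hA : A ⊆ Metric.ball 0 R)
    (hA0 : 0 ∉ A) {a : HAut} (ha : a ∉ badSet R η) (q : ℕ) :
    toXH a ∈ missing (A ×ˢ blocks 0 q 0 η) := by
  refine eq_empty_of_forall_notMem ?_
  rintro w ⟨⟨hw, ht⟩, m, n, k, rfl⟩
  rw [act_intPoint] at hw ht
  obtain ⟨j, -, ht1, ht2⟩ := mem_blocks_iff.1 ht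
  have hb := mem_ball_zero_iff.1 (hA hw)
  -- The single integer `j - k` absorbs both the tooth and the central coordinate, so the number `q`
  -- of teeth plays no role.
  refine ha (mem_badSet_iff.2 ⟨m, n, j - k, ?_, ⟨?_, ?_⟩, ?_, ?_⟩)
  · by_contra! h
    refine hA0 ?_
    convert hw using 1
    ext i
    fin_cases i <;> simp [h.1, h.2]
  · exact (PiLp.norm_apply_le (p := 2) (β := fun _ : Fin 2 => ℝ) _ 0).trans_lt hb
  · exact (PiLp.norm_apply_le (p := 2) (β := fun _ : Fin 2 => ℝ) _ 1).trans_lt hb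
  · push_cast; linarith
  · push_cast; linarith

lemma missing_subset_deviating {S : Set Space} {r : ℝ}
    (hr : r * √(volume S).toReal < (volume S).toReal / (riemannZeta 2).re) :
    missing S ⊆ deviating S r := by
  intro L hL
  have he : S ∩ primitivePoints L = ∅ := by
    refine eq_empty_of_forall_notMem ?_
    rintro w ⟨hw, a, m, n, k, hLa, -, rfl⟩
    have : act a (intPoint m n k) ∈ S ∩ L.1 := ⟨hw, by rw [hLa]; exact ⟨m, n, k, rfl⟩⟩
    rw [show S ∩ L.1 = ∅ from hL] at this
    exact this
  right
  rw [he, ncard_empty, Nat.cast_zero, zero_sub, abs_neg]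
  exact hr.trans_le (le_abs_self _)

lemma riemannZeta_two_re_pos : 0 < (riemannZeta 2).re := by
  have : (riemannZeta 2) = ((Real.pi ^ 2 / 6 : ℝ) : ℂ) := by rw [riemannZeta_two]; push_cast; rfl
  rw [this, Complex.ofReal_re]
  positivity

lemma fundamentalMeasure_nearIdentity_pos {κ : ℝ} (hκ : 0 < κ) :
    0 < fundamentalMeasure (nearIdentity κ) := by
  rw [fundamentalMeasure, ProbabilityTheory.cond_apply measurableSet_fundamentalSet]
  exact ENNReal.mul_pos (ENNReal.inv_ne_zero.2 haar_fundamentalSet_lt_top.ne)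
    (haar_fundamentalSet_inter_nearIdentity_pos hκ).ne'

lemma toXH_mem_missing_of_nearIdentity {ε R κ : ℝ} (hR : 0 < R)
    (hκε : 4 * κ * R ≤ ε) {S : Set Space}
    (hS : Prod.fst '' S ⊆ Metric.ball 0 R \ thickening ε R) {a : HAut}
    (ha : a ∈ nearIdentity κ) : toXH a ∈ missing S := by
  refine eq_empty_of_forall_notMem ?_
  rintro w ⟨hw, m, n, k, rfl⟩
  obtain ⟨hb, ht⟩ := hS (mem_image_of_mem _ hw)
  refine ht ⟨⟨m, n, ?_⟩, hb⟩
  rw [act_intPoint] at hb ⊢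
  rw [mem_ball_zero_iff] at hb
  have hd := invEntry_det a
  obtain ⟨h1, h2, h3, h4⟩ := ha
  set p := invEntry a 0 0 * m + invEntry a 1 0 * n with hp
  set q := invEntry a 0 1 * m + invEntry a 1 1 * n with hq
  have hpR : |p| < R :=
    (PiLp.norm_apply_le (p := 2) (β := fun _ : Fin 2 => ℝ) !₂[p, q] 0).trans_lt hb
  have hqR : |q| < R :=
    (PiLp.norm_apply_le (p := 2) (β := fun _ : Fin 2 => ℝ) !₂[p, q] 1).trans_lt hb
  have hκ : 0 < κ := (abs_nonneg _).trans_lt h1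
  have key {x y : ℝ} (hx : |x| < κ) (hy : |y| < κ) : |x * p + y * q| < 2 * κ * R := by
    refine (abs_add_le _ _).trans_lt ?_
    rw [abs_mul, abs_mul]
    have e1 := mul_le_mul hx.le hpR.le (abs_nonneg _) hκ.le
    have e2 := mul_lt_mul'' hy hqR (abs_nonneg _) (abs_nonneg _)
    linarith
  -- Solving for `m` and `n` through `h⁻¹` bounds the displacement by `|p|, |q| < R`, not by the
  -- size of `(m, n)`.
  have hm : p - m = (1 - invEntry a 1 1) * p + invEntry a 1 0 * q := by
    rw [hp, hq]; linear_combination (m : ℝ) * hd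
  have hn : q - n = invEntry a 0 1 * p + (1 - invEntry a 0 0) * q := by
    rw [hp, hq]; linear_combination (n : ℝ) * hd
  have hm' : |p - m| < 2 * κ * R := by
    rw [hm]; exact key (by rwa [abs_sub_comm]) h3
  have hn' : |q - n| < 2 * κ * R := by
    rw [hn]; exact key h2 (by rwa [abs_sub_comm])
  rw [mem_ball_iff_norm, EuclideanSpace.norm_eq, Fin.sum_univ_two]
  have hpos : 0 < 4 * κ * R := by positivity
  refine lt_of_lt_of_le ?_ hκε
  rw [Real.sqrt_lt' hpos]
  simp only [PiLp.sub_apply, Real.norm_eq_abs, Matrix.cons_val_zero, Matrix.cons_val_one]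
  nlinarith [abs_nonneg (p - m), abs_nonneg (q - n)]

end HeisenbergLattice

/-! ### Choice of the parameters. -/

theorem mainTheorem5 :
    ∃ c : ℝ → ℝ, (∀ ε' : ℝ, 0 < ε' → 0 < c ε') ∧
    ∀ ε : ℝ, 0 < ε →
      (∃ δ : ℝ, 0 < δ ∧
        ∀ (R : ℝ), 0 < R →
        ∀ A : Set HeisenbergLattice.Plane, MeasurableSet A → 0 < MeasureTheory.volume A →
          A ⊆ Metric.ball 0 R \ HeisenbergLattice.thickening ε R →
        ∀ M : ℝ, ∃ S : Set HeisenbergLattice.Space, MeasurableSet S ∧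
          (ENNReal.ofReal M ≤ MeasureTheory.volume S ∧ MeasureTheory.volume S < ⊤) ∧
          (∀ ε' : ℝ, 0 < ε' → ∀ C : Set HeisenbergLattice.Space, HeisenbergLattice.IsCylinder C →
            ENNReal.ofReal (c ε' * (MeasureTheory.volume S).toReal ^ (1 - ε')) <
              MeasureTheory.volume (symmDiff C S)) ∧
          Prod.fst '' S = A ∧
          ENNReal.ofReal δ ≤ HeisenbergLattice.muH (HeisenbergLattice.missing S) ∧
          (∃ r : ℝ, 0 < r ∧
            ENNReal.ofReal (M / r ^ 2) <
              HeisenbergLattice.muH (HeisenbergLattice.deviating S r))) ∧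
      (∀ R : ℝ, 0 < R → ∃ δ : ℝ, 0 < δ ∧
        ∀ S : Set HeisenbergLattice.Space, MeasurableSet S →
          Prod.fst '' S ⊆ Metric.ball 0 R \ HeisenbergLattice.thickening ε R →
          ENNReal.ofReal δ ≤ HeisenbergLattice.muH (HeisenbergLattice.missing S)) := by
  open HeisenbergLattice in
  refine ⟨fun _ => 1 / 6, fun _ _ => by norm_num, fun ε hε => ⟨⟨1 / 2, by norm_num, ?_⟩, ?_⟩⟩
  · intro R hR A hA hA0 hAR M
    obtain ⟨η, hη0, hη, hbad⟩ := exists_fundamentalMeasure_badSet_le R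
    have hAb : A ⊆ Metric.ball 0 R := hAR.trans sdiff_subset
    have hA0' : (0 : Plane) ∉ A := by
      intro h
      refine (hAR h).2 ⟨⟨0, 0, ?_⟩, Metric.mem_ball_self hR⟩
      rw [mem_ball_iff_norm, zero_sub, norm_neg]
      convert hε
      rw [norm_eq_zero]
      ext i; fin_cases i <;> simp
    have hAfin : volume A < ⊤ := (measure_mono hAb).trans_lt measure_ball_lt_top
    set v := (volume A).toReal with hv
    have hv0 : 0 < v := ENNReal.toReal_pos hA0.ne' hAfin.ne
    set z := (riemannZeta 2).re with hz
    have hz0 : 0 < z := riemannZeta_two_re_pos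
    -- With `W = J v η` and `m(S) = 3W`, the summand `|M|` gives the size of `S`, 1 gives `m(S) ^ (1
    -- - ε') ≤ m(S)`, and `8 z² |M|` defeats Chebyshev.
    obtain ⟨J, hJ⟩ := exists_nat_gt ((|M| + 1 + 8 * z ^ 2 * |M|) / (v * η))
    have hvη : 0 < v * η := mul_pos hv0 hη0
    rw [div_lt_iff₀ hvη] at hJ
    have hM0 := abs_nonneg M
    have hzM : 0 ≤ 8 * z ^ 2 * |M| := by positivity
    have hJ0 : 0 < J := by
      rcases Nat.eq_zero_or_pos J with h | h
      · rw [h, Nat.cast_zero, zero_mul] at hJ; linarith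
      · exact h
    set S : Set Space := A ×ˢ blocks 0 (3 * J) 0 η with hS
    set W := (J : ℝ) * (v * η) with hW
    have hvolA : volume A = ENNReal.ofReal v := (ENNReal.ofReal_toReal hAfin.ne).symm
    have hVS : volume S = ENNReal.ofReal (3 * W) := by
      rw [hS, Measure.volume_eq_prod, Measure.prod_prod, volume_blocks _ _ le_rfl (by linarith),
        hvolA, ← ENNReal.ofReal_natCast, ← ENNReal.ofReal_mul (by positivity),
        ← ENNReal.ofReal_mul (by positivity)]
      congr 1
      push_cast [hW, Nat.sub_zero]
      ring
    have hW0 : 0 < W := by linarith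
    have hVr : (volume S).toReal = 3 * W := by
      rw [hVS, ENNReal.toReal_ofReal (by linarith)]
    have hmiss : ENNReal.ofReal (1 / 2) ≤ muH (missing S) := by
      refine le_trans ?_ (fundamentalMeasure_preimage_le _)
      have hc : (badSet R η)ᶜ ⊆ toXH ⁻¹' missing S := fun a ha =>
        toXH_mem_missing_prod_blocks hAb hA0' ha _
      refine le_trans ?_ (measure_mono hc)
      rw [prob_compl_eq_one_sub (measurableSet_badSet R η)]
      have he : ENNReal.ofReal (1 / 2) = 1 - 1 / 2 := by
        rw [ENNReal.ofReal_div_of_pos two_pos]; simp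
      rw [he]
      exact tsub_le_tsub_left hbad 1
    refine ⟨S, hA.prod (measurableSet_blocks _ _ _ _), ⟨?_, ?_⟩, ?_, ?_, hmiss, ?_⟩
    · rw [hVS]
      exact ENNReal.ofReal_le_ofReal (by linarith [le_abs_self M])
    · rw [hVS]; exact ENNReal.ofReal_lt_top
    · intro ε' hε' C hC
      refine lt_of_lt_of_le ?_ (volume_symmDiff_cylinder_ge hA hC J hη0.le hη)
      rw [hVr, hvolA, ← ENNReal.ofReal_natCast, ← ENNReal.ofReal_mul (by positivity),
        ← ENNReal.ofReal_mul (by positivity)]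
      have hpow : (3 * W) ^ (1 - ε') ≤ 3 * W := by
        conv_rhs => rw [← Real.rpow_one (3 * W)]
        exact Real.rpow_le_rpow_of_exponent_le (by linarith) (by linarith)
      have hprod : v * (J * η) = W := by rw [hW]; ring
      rw [hprod]
      -- The symmetric difference has measure at least `W = m(S) / 3`; the constant 1/6 makes the
      -- inequality strict.
      exact (ENNReal.ofReal_lt_ofReal_iff hW0).2 (by linarith)
    · exact fst_image_prod _ ⟨0, mem_blocks_iff.2 ⟨0, by simp [hJ0], by simp [hη0]⟩⟩
    · have hs : 0 < √(3 * W) := Real.sqrt_pos.2 (by linarith)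
      have hsq : √(3 * W) ^ 2 = 3 * W := Real.sq_sqrt (by linarith)
      -- For this `r`, `r √m(S)` is half of the deviation `m(S) / ζ(2)` of a missing lattice, and `M
      -- / r² = 4 z² M / m(S)` falls below 1/2.
      refine ⟨√(3 * W) / (2 * z), by positivity, ?_⟩
      refine lt_of_lt_of_le ?_ (hmiss.trans (measure_mono (missing_subset_deviating ?_)))
      · refine (ENNReal.ofReal_lt_ofReal_iff (by norm_num)).2 ?_
        rw [div_pow, hsq, div_lt_iff₀ (by positivity), ← mul_div_assoc, lt_div_iff₀ (by positivity)]
        have : M * z ^ 2 ≤ |M| * z ^ 2 := by gcongr; exact le_abs_self M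
        nlinarith
      · rw [hVr, ← hz, div_mul_eq_mul_div, ← sq, hsq]
        exact div_lt_div_of_pos_left (by linarith) hz0 (by linarith)
  · intro R hR
    have hκ : 0 < ε / (4 * R) := by positivity
    have hpos := fundamentalMeasure_nearIdentity_pos hκ
    refine ⟨(fundamentalMeasure (nearIdentity (ε / (4 * R)))).toReal,
      ENNReal.toReal_pos hpos.ne' (measure_ne_top _ _), fun S _ hS => ?_⟩
    rw [ENNReal.ofReal_toReal (measure_ne_top _ _)]
    refine le_trans (measure_mono fun a ha => ?_) (fundamentalMeasure_preimage_le _)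
    exact toXH_mem_missing_of_nearIdentity hR (by field_simp; rfl) hS ha
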